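/- Let $X$ be a complex manifold of dimension $n$ and $(E,h^E)$ a holomorphic vector bundle of rank $r$ on $X$ with a smooth Hermitian metric. In a local holomorphic frame $\{e_i\}$ put $h_{i\bar k}=h^E(e_i,e_k)$; the Chern connection matrix is $\theta^j_i=\sum_k\partial h_{i\bar k}\,h^{\bar k j}$ and the Chern curvature matrix is $R=(R^j_i)$ ($j$ row, $i$ column), $R^j_i=\bar\partial\theta^j_i=\sum_{\alpha,\beta}R^j_{i\alpha\bar\beta}\,dz^\alpha\wedge d\bar z^\beta$ in local holomorphic coordinates $z^1,\dots,z^n$; put $R_{i\bar j\alpha\bar\beta}=\sum_k R^k_{i\alpha\bar\beta}h_{k\bar j}$. The bundle $(E,h^E)$ is called *Nakano positive* if at every point $\sum R_{i\bar j\alpha\bar\beta}u^{i\alpha}\overline{u^{j\beta}}>0$ for every non-zero $u=\sum u^{i\alpha}e_i\otimes\partial_\alpha\in E\otimes T^{1,0}X$, and *dual Nakano positive* if at every point $\sum R_{i\bar j\alpha\bar\beta}v^{\bar j\alpha}\overline{v^{\bar i\beta}}>0$ for every non-zero $v=\sum v^{\bar j\alpha}\bar e_j\otimes\partial_\alpha\in\overline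 E\otimes T^{1,0}X$. For an $r\times N$ matrix $A=(A_{jp})$ of $(1,0)$-forms at $x\in X$, $A_{jp}=\sum_\alpha A_{jp\alpha}dz^\alpha$, let $\mathbf A=(A_{jp\alpha})_{p,\,j\alpha}$, an $N\times rn$ matrix; for an $r\times N$ matrix $B=(B_{jp})$ of $(0,1)$-forms at $x$, $B_{jp}=\sum_\alpha B_{jp\bar\alpha}d\bar z^\alpha$, let $\mathbf B=(B_{jp\bar\alpha})_{p,\,j\alpha}$, also an $N\times rn$ matrix. By a unitary frame at $x$ we mean a holomorphic frame near $x$ with $h_{i\bar j}(x)=\delta_{ij}$. Then: 1. $(E,h^E)$ is Nakano positive if and only if for every $x\in X$ there are a unitary frame at $x$, an $N\in\mathbb N$ and an $r\times N$ matrix $B$ of $(0,1)$-forms at $x$ such that, at $x$, the Chern curvature matrix in this frame is $R=-B\wedge\overline B^{\top}$, and $\operatorname{rank}(\mathbf B)=rn$. 2. $(E,h^E)$ is dual Nakano positive if and only if for every $x\in X$ there are a unitary frame at $x$, an $N\in\mathbb N$ and an $r\times N$ matrix $A$ of $(1,0)$-forms at $x$ such that, at $x$, the Chern curvature matrix in this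 frame is $R=A\wedge\overline A^{\top}$, and $\operatorname{rank}(\mathbf A)=rn$. -/

import Mathlib

open scoped Manifold ContDiff ComplexOrder ComplexConjugate Bundle

noncomputable section

/-! ### Complex-valued forms at a point of a complex manifold

`X` is a complex manifold of dimension `n`: it is modelled on `ℂⁿ` and its transition maps are
holomorphic (`IsManifold 𝓘(ℂ, ℂⁿ) ω X`).  The tangent space `TangentSpace 𝓘(ℂ, ℂⁿ) x`, with its
complex structure, is the real tangent space `T_x X` with its almost complex structure; it is
identified with `T_x^{1,0} X` in the usual way, and with `ℂⁿ` by the coordinates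
`z¹, …, zⁿ` of the preferred holomorphic chart `chartAt _ x`. -/

/-- The model space `ℂⁿ`. -/
abbrev Cn (n : ℕ) : Type := EuclideanSpace ℂ (Fin n)

/-- The tangent space at `x` of a manifold modelled on `ℂⁿ`. -/
abbrev TanSp (n : ℕ) {X : Type*} [TopologicalSpace X] [ChartedSpace (Cn n) X] (x : X) : Type :=
  TangentSpace 𝓘(ℂ, Cn n) x

/-- Complex-valued `1`-forms at `x`: real-linear maps from the tangent space at `x` to `ℂ`. -/
abbrev OneForm (n : ℕ) {X : Type*} [TopologicalSpace X] [ChartedSpace (Cn n) X] (x : X) : Type :=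
  TanSp n x →ₗ[ℝ] ℂ

/-- Complex-valued `2`-forms at `x`: alternating real-bilinear maps from the tangent space at `x`
to `ℂ`. -/
abbrev TwoForm (n : ℕ) {X : Type*} [TopologicalSpace X] [ChartedSpace (Cn n) X] (x : X) : Type :=
  TanSp n x [⋀^Fin 2]→ₗ[ℝ] ℂ

section Forms

variable {n : ℕ} {X : Type*} [TopologicalSpace X] [ChartedSpace (Cn n) X] {x : X}

namespace OneForm

/-- A `(1,0)`-form at `x`: a complex-linear `1`-form. -/
def IsType10 (a : OneForm n x) : Prop := ∀ v : TanSp n x, a (Complex.I • v) = Complex.I * a v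

/-- A `(0,1)`-form at `x`: a conjugate-linear `1`-form. -/
def IsType01 (a : OneForm n x) : Prop := ∀ v : TanSp n x, a (Complex.I • v) = -(Complex.I * a v)

/-- The conjugate `1`-form. -/
def bar (a : OneForm n x) : OneForm n x := Complex.conjAe.toLinearMap ∘ₗ a

/-- The wedge product of two `1`-forms, `(a ∧ b)(v, w) = a(v) b(w) - a(w) b(v)`. -/
def wedge (a b : OneForm n x) : TwoForm n x where
  toFun v := a (v 0) * b (v 1) - a (v 1) * b (v 0)
  map_update_add' v i y z := by
    fin_cases i <;> simp <;> ring
  map_update_smul' v i c y := by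
    fin_cases i <;> simp <;> ring
  map_eq_zero_of_eq' v i j h hij := by
    fin_cases i <;> fin_cases j <;> simp_all

end OneForm

/-- The coordinate tangent vector at `x` in the direction `z^α` (the real vector `∂/∂x^α`, which
corresponds to `∂/∂z^α` in `T_x^{1,0} X`). -/
def coordVec (n : ℕ) {X : Type*} [TopologicalSpace X] [ChartedSpace (Cn n) X] (x : X)
    (α : Fin n) : TanSp n x :=
  (EuclideanSpace.single α (1 : ℂ) : Cn n)

/-- The `(1,0)`-form `dz^α` at `x`. -/
def dz (n : ℕ) {X : Type*} [TopologicalSpace X] [ChartedSpace (Cn n) X] (x : X)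
    (α : Fin n) : OneForm n x where
  toFun v := (show Cn n from v) α
  map_add' _ _ := rfl
  map_smul' _ _ := rfl

/-- The coefficient `a_α` of `a = ∑ a_α dz^α` for a `(1,0)`-form `a`, respectively `a_{ᾱ}` of
`a = ∑ a_{ᾱ} dz̄^α` for a `(0,1)`-form `a`. -/
def OneForm.coeff (a : OneForm n x) (α : Fin n) : ℂ := a (coordVec n x α)

/-- The product `A ∧ Cᵀ` of matrices of `1`-forms: its `(j, i)` entry is `∑_p A_{jp} ∧ C_{ip}`. -/
def wedgeTranspose {r N : ℕ} (A C : Matrix (Fin r) (Fin N) (OneForm n x)) :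
    Matrix (Fin r) (Fin r) (TwoForm n x) :=
  Matrix.of fun j i => ∑ p, (A j p).wedge (C i p)

/-- The matrix of coefficients of an `r × N` matrix `A` of `1`-forms: an `N × rn` matrix whose
entry in row `p` and column `(j, α)` is the coefficient `A_{jpα}`. -/
def coeffMatrix {r N : ℕ} (A : Matrix (Fin r) (Fin N) (OneForm n x)) :
    Matrix (Fin N) (Fin r × Fin n) ℂ :=
  Matrix.of fun p jα => (A jα.1 p).coeff jα.2

end Forms

/-! ### Wirtinger derivatives on `ℂⁿ` -/

/-- `∂f/∂z^α = (∂f/∂x^α - i ∂f/∂y^α) / 2`. -/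
def wirtinger {n : ℕ} (α : Fin n) (f : Cn n → ℂ) (z : Cn n) : ℂ :=
  (fderiv ℝ f z (EuclideanSpace.single α (1 : ℂ))
    - Complex.I * fderiv ℝ f z (EuclideanSpace.single α Complex.I)) / 2

/-- `∂f/∂z̄^α = (∂f/∂x^α + i ∂f/∂y^α) / 2`. -/
def wirtingerBar {n : ℕ} (α : Fin n) (f : Cn n → ℂ) (z : Cn n) : ℂ :=
  (fderiv ℝ f z (EuclideanSpace.single α (1 : ℂ))
    + Complex.I * fderiv ℝ f z (EuclideanSpace.single α Complex.I)) / 2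

/-! ### Hermitian holomorphic vector bundles and their Chern curvature -/

section Bundle

variable (n r : ℕ) {X : Type*} [TopologicalSpace X] [ChartedSpace (Cn n) X]
  (E : X → Type*) [TopologicalSpace (Bundle.TotalSpace (Cn r) E)]
  [∀ x, AddCommGroup (E x)] [∀ x, Module ℂ (E x)] [∀ x, TopologicalSpace (E x)]
  [FiberBundle (Cn r) E]

/-- A smooth Hermitian metric on a holomorphic vector bundle `E` of rank `r`: a positive definite
Hermitian form on each fibre, linear in the first and conjugate-linear in the second variable,
such that `h(s, t)` is a smooth function (in the real sense) for all local holomorphic sections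
`s` and `t`. -/
structure HermitianMetric where
  form : ∀ x : X, E x →ₗ[ℂ] E x →ₗ⋆[ℂ] ℂ
  conj_symm : ∀ (x : X) (v w : E x), conj (form x v w) = form x w v
  pos : ∀ (x : X) (v : E x), v ≠ 0 → 0 < form x v v
  smooth : ∀ (U : Set X), IsOpen U → ∀ s t : (Π x : X, E x),
    ContMDiffOn 𝓘(ℂ, Cn n) (𝓘(ℂ, Cn n).prod 𝓘(ℂ, Cn r)) ω
      (fun y => Bundle.TotalSpace.mk' (Cn r) y (s y)) U →
    ContMDiffOn 𝓘(ℂ, Cn n) (𝓘(ℂ, Cn n).prod 𝓘(ℂ, Cn r)) ω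
      (fun y => Bundle.TotalSpace.mk' (Cn r) y (t y)) U →
    ContMDiffOn 𝓘(ℝ, Cn n) 𝓘(ℝ, ℂ) ∞ (fun y => form y (s y) (t y)) U

/-- `e = (e_1, …, e_r)` is a holomorphic frame of `E` on some open neighbourhood of `x`. -/
def IsHolFrameNear (x : X) (e : Fin r → Π y : X, E y) : Prop :=
  ∃ U : Set X, IsOpen U ∧ x ∈ U ∧ IsLocalFrameOn 𝓘(ℂ, Cn n) (Cn r) ω e U

namespace HermitianMetric

variable {n r E} (h : HermitianMetric n r E)

/-- The matrix `h_{i k̄} = h(e_i, e_k)` of the metric in the frame `e`, as a function of the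
coordinates `z` of the preferred chart at `x`. -/
def gram (e : Fin r → Π y : X, E y) (x : X) (z : Cn n) : Matrix (Fin r) (Fin r) ℂ :=
  Matrix.of fun i k =>
    h.form ((chartAt (Cn n) x).symm z) (e i ((chartAt (Cn n) x).symm z))
      (e k ((chartAt (Cn n) x).symm z))

/-- The coefficients `θ^j_{iα}` of the Chern connection form `θ^j_i = ∑_k ∂h_{i k̄} h^{k̄ j}` with
respect to the holomorphic frame `e` (so `∇ e_i = ∑_j θ^j_i e_j`, `θ^j_i = ∑_α θ^j_{iα} dz^α`), in
the coordinates of the preferred chart at `x`. -/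
def connectionCoeff (e : Fin r → Π y : X, E y) (x : X) (j i : Fin r) (α : Fin n) (z : Cn n) : ℂ :=
  ∑ k, wirtinger α (fun w => h.gram e x w i k) z * (h.gram e x z)⁻¹ k j

/-- The coefficients `R^j_{iαβ̄}` at `x` of the Chern curvature
`R^j_i = ∂̄θ^j_i = ∑_{α,β} R^j_{iαβ̄} dz^α ∧ dz̄^β` in the holomorphic frame `e`;
the sign comes from `dz̄^β ∧ dz^α = - dz^α ∧ dz̄^β`. -/
def curvatureCoeff (e : Fin r → Π y : X, E y) (x : X) (j i : Fin r) (α β : Fin n) : ℂ :=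
  -wirtingerBar β (h.connectionCoeff e x j i α) (chartAt (Cn n) x x)

/-- The Chern curvature matrix `R = (R^j_i)` (`j` row, `i` column) at `x` with respect to the
holomorphic frame `e`, a matrix of `2`-forms at `x`. -/
def curvatureMatrix (e : Fin r → Π y : X, E y) (x : X) :
    Matrix (Fin r) (Fin r) (TwoForm n x) :=
  Matrix.of fun j i =>
    ∑ α, ∑ β, h.curvatureCoeff e x j i α β • (dz n x α).wedge (dz n x β).bar

/-- `R_{i j̄ α β̄} = ∑_k R^k_{iαβ̄} h_{k j̄}` at `x`. -/
def curvatureLower (e : Fin r → Π y : X, E y) (x : X) (i j : Fin r) (α β : Fin n) : ℂ :=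
  ∑ k, h.curvatureCoeff e x k i α β * h.form x (e k x) (e j x)

/-- Nakano positivity: `R_{i j̄ α β̄} u^{iα} conj(u^{jβ}) > 0` for all nonzero
`u = u^{iα} e_i ⊗ ∂_α` in `E ⊗ T^{1,0} X`, whatever the holomorphic frame. -/
def NakanoPositive : Prop :=
  ∀ (x : X) (e : Fin r → Π y : X, E y), IsHolFrameNear n r E x e →
    ∀ u : Fin r → Fin n → ℂ, u ≠ 0 →
      0 < ∑ i, ∑ j, ∑ α, ∑ β, h.curvatureLower e x i j α β * u i α * conj (u j β)

/-- Dual Nakano positivity: `R_{i j̄ α β̄} v^{j̄α} conj(v^{īβ}) > 0` for all nonzero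
`v = v^{j̄α} ē_j ⊗ ∂_α` in `Ē ⊗ T^{1,0} X`, whatever the holomorphic frame. -/
def DualNakanoPositive : Prop :=
  ∀ (x : X) (e : Fin r → Π y : X, E y), IsHolFrameNear n r E x e →
    ∀ v : Fin r → Fin n → ℂ, v ≠ 0 →
      0 < ∑ i, ∑ j, ∑ α, ∑ β, h.curvatureLower e x i j α β * v j α * conj (v i β)

/-- The frame `e` is unitary at `x`. -/
def IsUnitaryAt (e : Fin r → Π y : X, E y) (x : X) : Prop :=
  ∀ i j, h.form x (e i x) (e j x) = if i = j then 1 else 0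

end HermitianMetric

end Bundle

end

/-! Work at one point, in a frame unitary there, so that `R_{i j̄ α β̄} = R^j_{iαβ̄}`. Expanding the
wedge products, `R = -B ∧ B̄ᵀ` says `R_{i j̄ α β̄} = ∑_p conj(B_{ipᾱ}) B_{jpβ̄}`, and `R = A ∧ Āᵀ`
says `R_{i j̄ α β̄} = ∑_p A_{jpα} conj(A_{ipβ})`. With the indices grouped in pairs, as in
`nakanoMat` and `dualNakanoMat`, each identity reads `M = Cᴴ * C`, where `M` is the matrix of the
quadratic form whose positivity is at stake and `C` is the conjugate of `coeffMatrix B`,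
respectively `coeffMatrix A`. Such a Gram matrix is positive definite exactly when `C` has full
column rank, and every positive definite matrix is one: this gives `posDef_nakanoMat_iff` and
`posDef_dualNakanoMat_iff`.

Positivity is required in all holomorphic frames, a factorization only in one unitary frame. The two
are linked by tensoriality of the curvature: a holomorphic change of frame `G` turns `L_{αβ} = (R_{i
j̄ α β̄})_{ij}` into `G L_{αβ} Gᴴ` (`lowerMat_change_frame`), which is a congruence of the block
matrices and preserves positive definiteness. A trivialization supplies a unitary frame against
which all others are compared (`exists_lowerMat_eq`). -/

noncomputable section

/-! ### Wirtinger calculus -/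

section Wirtinger

variable {n : ℕ} {α : Fin n} {f g : Cn n → ℂ} {z : Cn n}

lemma wirtinger_congr (hfg : f =ᶠ[nhds z] g) : wirtinger α f z = wirtinger α g z := by
  simp only [wirtinger, hfg.fderiv_eq]

lemma wirtingerBar_congr (hfg : f =ᶠ[nhds z] g) : wirtingerBar α f z = wirtingerBar α g z := by
  simp only [wirtingerBar, hfg.fderiv_eq]

lemma wirtingerBar_add (hf : DifferentiableAt ℝ f z) (hg : DifferentiableAt ℝ g z) :
    wirtingerBar α (fun w => f w + g w) z = wirtingerBar α f z + wirtingerBar α g z := by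
  simp only [wirtingerBar, fderiv_fun_add hf hg, _root_.add_apply]
  ring

lemma wirtinger_mul (hf : DifferentiableAt ℝ f z) (hg : DifferentiableAt ℝ g z) :
    wirtinger α (fun w => f w * g w) z = wirtinger α f z * g z + f z * wirtinger α g z := by
  simp only [wirtinger, fderiv_fun_mul hf hg, _root_.add_apply,
    _root_.smul_apply, smul_eq_mul]
  ring

lemma wirtingerBar_mul (hf : DifferentiableAt ℝ f z) (hg : DifferentiableAt ℝ g z) :
    wirtingerBar α (fun w => f w * g w) z =
      wirtingerBar α f z * g z + f z * wirtingerBar α g z := by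
  simp only [wirtingerBar, fderiv_fun_mul hf hg, _root_.add_apply,
    _root_.smul_apply, smul_eq_mul]
  ring

lemma wirtinger_sum {ι : Type*} (s : Finset ι) {F : ι → Cn n → ℂ}
    (hF : ∀ i ∈ s, DifferentiableAt ℝ (F i) z) :
    wirtinger α (fun w => ∑ i ∈ s, F i w) z = ∑ i ∈ s, wirtinger α (F i) z := by
  simp only [wirtinger, fderiv_fun_sum hF, _root_.sum_apply, Finset.mul_sum,
    ← Finset.sum_sub_distrib, Finset.sum_div]

lemma wirtingerBar_sum {ι : Type*} (s : Finset ι) {F : ι → Cn n → ℂ}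
    (hF : ∀ i ∈ s, DifferentiableAt ℝ (F i) z) :
    wirtingerBar α (fun w => ∑ i ∈ s, F i w) z = ∑ i ∈ s, wirtingerBar α (F i) z := by
  simp only [wirtingerBar, fderiv_fun_sum hF, _root_.sum_apply, Finset.mul_sum,
    ← Finset.sum_add_distrib, Finset.sum_div]

lemma wirtinger_conj (hf : DifferentiableAt ℝ f z) :
    wirtinger α (fun w => conj (f w)) z = conj (wirtingerBar α f z) := by
  have h1 : fderiv ℝ (fun w => conj (f w)) z
      = (Complex.conjCLE : ℂ →L[ℝ] ℂ).comp (fderiv ℝ f z) :=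
    ((Complex.conjCLE : ℂ →L[ℝ] ℂ).hasFDerivAt.comp z hf.hasFDerivAt).fderiv
  simp [wirtinger, wirtingerBar, h1, sub_eq_add_neg, map_ofNat]

/-- The Cauchy–Riemann equations; they make `∂̄` vanish on holomorphic functions and `∂` agree with
the complex derivative. -/
lemma fderiv_real_apply_I (hf : DifferentiableAt ℂ f z) (α : Fin n) :
    fderiv ℝ f z (EuclideanSpace.single α Complex.I)
      = Complex.I * fderiv ℂ f z (EuclideanSpace.single α 1) := by
  have h1 : fderiv ℝ f z = (fderiv ℂ f z).restrictScalars ℝ := hf.fderiv_restrictScalars ℝ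
  have h2 : (EuclideanSpace.single α Complex.I : Cn n)
      = Complex.I • EuclideanSpace.single α (1 : ℂ) := by
    ext i; simp
  rw [h1, h2, ContinuousLinearMap.coe_restrictScalars', map_smul, smul_eq_mul]

lemma wirtingerBar_eq_zero (hf : DifferentiableAt ℂ f z) : wirtingerBar α f z = 0 := by
  have h1 : fderiv ℝ f z = (fderiv ℂ f z).restrictScalars ℝ := hf.fderiv_restrictScalars ℝ
  rw [wirtingerBar, fderiv_real_apply_I hf, h1, ContinuousLinearMap.coe_restrictScalars',
    ← mul_assoc, Complex.I_mul_I]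
  ring

lemma wirtinger_eq_fderiv (hf : DifferentiableAt ℂ f z) :
    wirtinger α f z = fderiv ℂ f z (EuclideanSpace.single α 1) := by
  have h1 : fderiv ℝ f z = (fderiv ℂ f z).restrictScalars ℝ := hf.fderiv_restrictScalars ℝ
  rw [wirtinger, fderiv_real_apply_I hf, h1, ContinuousLinearMap.coe_restrictScalars',
    ← mul_assoc, Complex.I_mul_I]
  ring

/-- Ensures `∂̄∂G = 0` for a holomorphic change of frame `G`. -/
lemma AnalyticAt.wirtinger (hf : AnalyticAt ℂ f z) : AnalyticAt ℂ (wirtinger α f) z := by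
  have h1 : AnalyticAt ℂ (fun w => fderiv ℂ f w (EuclideanSpace.single α 1)) z :=
    (ContinuousLinearMap.apply ℂ ℂ (EuclideanSpace.single α (1 : ℂ) : Cn n)).analyticAt _
      |>.comp hf.fderiv
  refine h1.congr ?_
  filter_upwards [hf.eventually_analyticAt] with w hw
  exact (wirtinger_eq_fderiv hw.differentiableAt).symm

lemma ContDiffAt.differentiableAt_wirtinger (hf : ContDiffAt ℝ 2 f z) :
    DifferentiableAt ℝ (_root_.wirtinger α f) z := by
  have h1 : DifferentiableAt ℝ (fderiv ℝ f) z :=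
    (hf.fderiv_right (m := 1) (by norm_num)).differentiableAt (by norm_num)
  unfold _root_.wirtinger
  fun_prop

lemma ContDiffAt.eventually_differentiableAt (hf : ContDiffAt ℝ 2 f z) :
    ∀ᶠ w in nhds z, DifferentiableAt ℝ f w := by
  filter_upwards [hf.eventually (by simp)] with w hw
  exact hw.differentiableAt (by norm_num)

end Wirtinger

/-! ### Matrix-valued functions and the Chern connection -/

section MatrixWirtinger

variable {n r : ℕ} {α β : Fin n} {A B G H : Cn n → Matrix (Fin r) (Fin r) ℂ} {z : Cn n}

/-- The entrywise derivative `∂A/∂z^α` of a matrix-valued function. -/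
def wirtingerMat (α : Fin n) (A : Cn n → Matrix (Fin r) (Fin r) ℂ) (z : Cn n) :
    Matrix (Fin r) (Fin r) ℂ :=
  Matrix.of fun i j => wirtinger α (fun w => A w i j) z

/-- The entrywise derivative `∂A/∂z̄^α` of a matrix-valued function. -/
def wirtingerBarMat (α : Fin n) (A : Cn n → Matrix (Fin r) (Fin r) ℂ) (z : Cn n) :
    Matrix (Fin r) (Fin r) ℂ :=
  Matrix.of fun i j => wirtingerBar α (fun w => A w i j) z

/-- The coefficient of `dz^α` in the Chern connection `∂H · H⁻¹`. -/
def chernMat (α : Fin n) (H : Cn n → Matrix (Fin r) (Fin r) ℂ) (z : Cn n) :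
    Matrix (Fin r) (Fin r) ℂ :=
  wirtingerMat α H z * (H z)⁻¹

lemma wirtingerMat_congr (h : A =ᶠ[nhds z] B) : wirtingerMat α A z = wirtingerMat α B z := by
  ext i j
  exact wirtinger_congr (h.mono fun w hw => by simp only [hw])

lemma wirtingerBarMat_congr (h : A =ᶠ[nhds z] B) :
    wirtingerBarMat α A z = wirtingerBarMat α B z := by
  ext i j
  exact wirtingerBar_congr (h.mono fun w hw => by simp only [hw])

lemma differentiableAt_matrix_mul (hA : ∀ i j, DifferentiableAt ℝ (fun w => A w i j) z)
    (hB : ∀ i j, DifferentiableAt ℝ (fun w => B w i j) z) (i j : Fin r) :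
    DifferentiableAt ℝ (fun w => (A w * B w) i j) z := by
  simp only [Matrix.mul_apply]
  exact DifferentiableAt.fun_sum fun k _ => (hA i k).mul (hB k j)

lemma differentiableAt_matrix_det (hA : ∀ i j, DifferentiableAt ℝ (fun w => A w i j) z) :
    DifferentiableAt ℝ (fun w => (A w).det) z := by
  simp only [Matrix.det_apply]
  refine DifferentiableAt.fun_sum fun σ _ => ?_
  exact DifferentiableAt.const_smul (R := ℤˣ)
    (HasFDerivAt.finsetProd fun i _ => (hA (σ i) i).hasFDerivAt).differentiableAt _

lemma differentiableAt_matrix_inv (hA : ∀ i j, DifferentiableAt ℝ (fun w => A w i j) z)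
    (hdet : (A z).det ≠ 0) (i j : Fin r) :
    DifferentiableAt ℝ (fun w => (A w)⁻¹ i j) z := by
  -- Cramer's formula: an entry of the adjugate is the determinant of a matrix with one row replaced
  -- by a constant vector.
  simp only [Matrix.inv_def, Ring.inverse_eq_inv', Matrix.smul_apply, smul_eq_mul,
    Matrix.adjugate_apply]
  refine ((differentiableAt_matrix_det hA).inv hdet).mul (differentiableAt_matrix_det ?_)
  intro k l
  by_cases hk : k = j
  · subst hk; simp
  · simpa [Matrix.updateRow_ne hk] using hA k l

lemma wirtingerMat_mul (hA : ∀ i j, DifferentiableAt ℝ (fun w => A w i j) z)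
    (hB : ∀ i j, DifferentiableAt ℝ (fun w => B w i j) z) :
    wirtingerMat α (fun w => A w * B w) z
      = wirtingerMat α A z * B z + A z * wirtingerMat α B z := by
  ext i j
  simp only [wirtingerMat, Matrix.of_apply, Matrix.add_apply, Matrix.mul_apply]
  rw [wirtinger_sum _ fun k _ => (hA i k).fun_mul (hB k j), ← Finset.sum_add_distrib]
  exact Finset.sum_congr rfl fun k _ => wirtinger_mul (hA i k) (hB k j)

lemma wirtingerBarMat_mul (hA : ∀ i j, DifferentiableAt ℝ (fun w => A w i j) z)
    (hB : ∀ i j, DifferentiableAt ℝ (fun w => B w i j) z) :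
    wirtingerBarMat α (fun w => A w * B w) z
      = wirtingerBarMat α A z * B z + A z * wirtingerBarMat α B z := by
  ext i j
  simp only [wirtingerBarMat, Matrix.of_apply, Matrix.add_apply, Matrix.mul_apply]
  rw [wirtingerBar_sum _ fun k _ => (hA i k).fun_mul (hB k j), ← Finset.sum_add_distrib]
  exact Finset.sum_congr rfl fun k _ => wirtingerBar_mul (hA i k) (hB k j)

lemma wirtingerBarMat_add (hA : ∀ i j, DifferentiableAt ℝ (fun w => A w i j) z)
    (hB : ∀ i j, DifferentiableAt ℝ (fun w => B w i j) z) :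
    wirtingerBarMat α (fun w => A w + B w) z = wirtingerBarMat α A z + wirtingerBarMat α B z := by
  ext i j
  exact wirtingerBar_add (hA i j) (hB i j)

lemma wirtingerBarMat_eq_zero (hA : ∀ i j, DifferentiableAt ℂ (fun w => A w i j) z) :
    wirtingerBarMat α A z = 0 := by
  ext i j
  exact wirtingerBar_eq_zero (hA i j)

lemma wirtingerMat_conjTranspose_eq_zero (hA : ∀ i j, DifferentiableAt ℂ (fun w => A w i j) z) :
    wirtingerMat α (fun w => (A w).conjTranspose) z = 0 := by
  ext i j
  have := wirtinger_conj (α := α) ((hA j i).restrictScalars ℝ)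
  rw [wirtingerBar_eq_zero (hA j i), map_zero] at this
  exact this

lemma differentiableAt_matrix_conjTranspose
    (hA : ∀ i j, DifferentiableAt ℝ (fun w => A w i j) z) (i j : Fin r) :
    DifferentiableAt ℝ (fun w => (A w).conjTranspose i j) z :=
  (Complex.conjCLE : ℂ →L[ℝ] ℂ).differentiableAt.comp z (hA j i)

lemma differentiableAt_chernMat (hH : ∀ i j, ContDiffAt ℝ 2 (fun w => H w i j) z)
    (hdet : (H z).det ≠ 0) (i j : Fin r) :
    DifferentiableAt ℝ (fun w => chernMat α H w i j) z :=
  differentiableAt_matrix_mul (fun k l => (hH k l).differentiableAt_wirtinger)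
    (differentiableAt_matrix_inv (fun k l => (hH k l).differentiableAt (by norm_num)) hdet) i j

/-- The gauge law `θ' = ∂G G⁻¹ + G θ G⁻¹`, which follows from the product rule and `∂(Gᴴ) = 0`.
Multiplying by `G` on the right keeps `G⁻¹` out of the next differentiation. -/
lemma chernMat_change_frame (hH : ∀ i j, DifferentiableAt ℝ (fun w => H w i j) z)
    (hG : ∀ i j, DifferentiableAt ℂ (fun w => G w i j) z)
    (hHdet : (H z).det ≠ 0) (hGdet : (G z).det ≠ 0) :
    chernMat α (fun w => G w * H w * (G w).conjTranspose) z * G z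
      = wirtingerMat α G z + G z * chernMat α H z := by
  have hG' : ∀ i j, DifferentiableAt ℝ (fun w => G w i j) z := fun i j =>
    (hG i j).restrictScalars ℝ
  have hGs : ((G z).conjTranspose).det ≠ 0 := by
    rw [Matrix.det_conjTranspose]; simpa using hGdet
  have u1 : (H z) * (H z)⁻¹ = 1 := Matrix.mul_nonsing_inv _ (isUnit_iff_ne_zero.mpr hHdet)
  have u2 : (G z)⁻¹ * (G z) = 1 := Matrix.nonsing_inv_mul _ (isUnit_iff_ne_zero.mpr hGdet)
  have u3 : (G z).conjTranspose * ((G z).conjTranspose)⁻¹ = 1 :=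
    Matrix.mul_nonsing_inv _ (isUnit_iff_ne_zero.mpr hGs)
  rw [chernMat, chernMat, wirtingerMat_mul (differentiableAt_matrix_mul hG' hH)
    (differentiableAt_matrix_conjTranspose hG'), wirtingerMat_conjTranspose_eq_zero hG,
    wirtingerMat_mul hG' hH, mul_zero, add_zero, Matrix.mul_inv_rev, Matrix.mul_inv_rev]
  simp only [mul_assoc, u2, mul_one]
  rw [← mul_assoc (G z).conjTranspose, u3, one_mul, add_mul, mul_assoc, u1, mul_one, mul_assoc]

/-- Apply `∂̄` to the gauge law `θ' G = ∂G + G θ`: both `∂̄G` and `∂̄∂G` vanish, so the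
inhomogeneous term disappears. -/
lemma wirtingerBarMat_chernMat_change_frame {H' : Cn n → Matrix (Fin r) (Fin r) ℂ}
    (hH : ∀ i j, ContDiffAt ℝ 2 (fun w => H w i j) z)
    (hH2 : ∀ i j, ContDiffAt ℝ 2 (fun w => H' w i j) z)
    (hG : ∀ i j, AnalyticAt ℂ (fun w => G w i j) z)
    (hHdet : (H z).det ≠ 0) (hGdet : (G z).det ≠ 0)
    (hH' : H' =ᶠ[nhds z] fun w => G w * H w * (G w).conjTranspose) :
    wirtingerBarMat β (chernMat α H') z * G z = G z * wirtingerBarMat β (chernMat α H) z := by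
  have hGd : ∀ i j, DifferentiableAt ℂ (fun w => G w i j) z := fun i j =>
    (hG i j).differentiableAt
  have hGr : ∀ i j, DifferentiableAt ℝ (fun w => G w i j) z := fun i j =>
    (hGd i j).restrictScalars ℝ
  have hHr : ∀ i j, DifferentiableAt ℝ (fun w => H w i j) z := fun i j =>
    (hH i j).differentiableAt (by norm_num)
  have hH'det : (H' z).det ≠ 0 := by
    rw [hH'.self_of_nhds, Matrix.det_mul, Matrix.det_mul, Matrix.det_conjTranspose]
    simp [hGdet, hHdet]
  -- The gauge law is needed on a neighbourhood, since it is about to be differentiated.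
  have key : (fun w => chernMat α H' w * G w)
      =ᶠ[nhds z] fun w => wirtingerMat α G w + G w * chernMat α H w := by
    have e1 : ∀ᶠ w in nhds z, ∀ i j, DifferentiableAt ℝ (fun w => H w i j) w := by
      simp only [Filter.eventually_all]
      exact fun i j => (hH i j).eventually_differentiableAt
    have e2 : ∀ᶠ w in nhds z, ∀ i j, DifferentiableAt ℂ (fun w => G w i j) w := by
      simp only [Filter.eventually_all]
      exact fun i j => (hG i j).eventually_analyticAt.mono fun w hw => hw.differentiableAt
    have e3 := (differentiableAt_matrix_det hHr).continuousAt.eventually_ne hHdet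
    have e4 := (differentiableAt_matrix_det hGr).continuousAt.eventually_ne hGdet
    filter_upwards [e1, e2, e3, e4, hH'.eventually_nhds] with w h1 h2 h3 h4 h5
    have := chernMat_change_frame (α := α) h1 h2 h3 h4
    rw [← this]
    congr 1
    rw [chernMat, chernMat, wirtingerMat_congr h5, h5.self_of_nhds]
  have h1 := wirtingerBarMat_congr (α := β) key
  have hGw : ∀ i j, DifferentiableAt ℂ (fun w => wirtingerMat α G w i j) z := fun i j =>
    ((hG i j).wirtinger).differentiableAt
  rwa [wirtingerBarMat_mul (differentiableAt_chernMat hH2 hH'det) hGr,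
    wirtingerBarMat_add (fun i j => (hGw i j).restrictScalars ℝ)
      (differentiableAt_matrix_mul hGr (differentiableAt_chernMat hH hHdet)),
    wirtingerBarMat_mul hGr (differentiableAt_chernMat hH hHdet),
    wirtingerBarMat_eq_zero hGd, wirtingerBarMat_eq_zero hGw, mul_zero, add_zero, zero_mul,
    zero_add, zero_add] at h1

end MatrixWirtinger

end

noncomputable section

/-! ### Positive definite complex matrices -/

section PosDef

open Matrix

/-- In the order on `ℂ`, being positive includes being real, and a complex matrix with real
quadratic form is Hermitian by polarization. -/
lemma Matrix.posDef_of_forall_pos {ι : Type*} [Fintype ι] {M : Matrix ι ι ℂ}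
    (hM : ∀ x : ι → ℂ, x ≠ 0 → 0 < star x ⬝ᵥ (M *ᵥ x)) : M.PosDef := by
  classical
  refine .of_dotProduct_mulVec_pos ?_ fun x hx => hM x hx
  rw [← Matrix.isSymmetric_toEuclideanLin_iff, LinearMap.isSymmetric_iff_inner_map_self_real]
  intro v
  have h0 : 0 ≤ star v.ofLp ⬝ᵥ (M *ᵥ v.ofLp) := by
    by_cases hv : v.ofLp = 0
    · simp [hv]
    · exact (hM _ hv).le
  have h1 : inner ℂ (M.toEuclideanLin v) v = conj (star v.ofLp ⬝ᵥ (M *ᵥ v.ofLp)) := by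
    rw [← inner_conj_symm, EuclideanSpace.inner_eq_star_dotProduct, dotProduct_comm]
    rfl
  rw [h1, Complex.conj_conj, Complex.conj_eq_iff_im.mpr (Complex.nonneg_iff.mp h0).2.symm]

/-- A positive semidefinite matrix is definite iff it is invertible, and `Cᴴ * C` has the same rank
as `C`. -/
lemma Matrix.posDef_conjTranspose_mul_self_iff_rank {ι κ : Type*} [Fintype ι] [Fintype κ]
    (C : Matrix κ ι ℂ) : (Cᴴ * C).PosDef ↔ C.rank = Fintype.card ι := by
  classical
  rw [(posSemidef_conjTranspose_mul_self C).posDef_iff_isUnit, ← rank_conjTranspose_mul_self]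
  refine ⟨fun h => rank_of_isUnit _ h, fun h => ?_⟩
  rw [← Matrix.linearIndependent_cols_iff_isUnit]
  refine linearIndependent_iff_card_eq_finrank_span.mpr ?_
  rw [← h, Matrix.rank_eq_finrank_span_cols]
  rfl

lemma Matrix.PosDef.exists_conjTranspose_mul_self {ι : Type*} [Fintype ι] {M : Matrix ι ι ℂ}
    (hM : M.PosDef) : ∃ C : Matrix (Fin (Fintype.card ι)) ι ℂ, M = Cᴴ * C := by
  classical
  open scoped MatrixOrder in
  obtain ⟨S, hS⟩ := CStarAlgebra.nonneg_iff_eq_star_mul_self.mp hM.posSemidef.nonneg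
  -- Only the rows of the square factor `S` are renumbered, so that they can index the columns of a
  -- matrix of forms.
  refine ⟨S.submatrix (Fintype.equivFin ι).symm id, ?_⟩
  rw [hS, conjTranspose_submatrix, submatrix_mul_equiv]
  rfl

lemma exists_orthonormal_basis_of_form {r : ℕ} {V : Type*} [AddCommGroup V] [Module ℂ V]
    [FiniteDimensional ℂ V] (hr : Module.finrank ℂ V = r) (φ : V →ₗ[ℂ] V →ₗ⋆[ℂ] ℂ)
    (hsymm : ∀ v w, conj (φ v w) = φ w v) (hpos : ∀ v, v ≠ 0 → 0 < φ v v) :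
    ∃ b : Module.Basis (Fin r) ℂ V, ∀ i j, φ (b i) (b j) = if i = j then 1 else 0 := by
  let c : InnerProductSpace.Core ℂ V :=
    -- The arguments are exchanged: `φ` is linear in its first variable, `inner` in its second.
    { inner := fun v w => φ w v
      conj_inner_symm := fun v w => hsymm _ _
      re_inner_nonneg := fun v => by
        by_cases hv : v = 0
        · simp [hv]
        · exact (Complex.pos_iff.mp (hpos v hv)).1.le
      add_left := fun v w u => by simp
      smul_left := fun v w a => by simp
      definite := fun v hv => by
        by_contra h
        exact (hpos v h).ne' hv }
  let : NormedAddCommGroup V := c.toNormedAddCommGroup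
  let : InnerProductSpace ℂ V := InnerProductSpace.ofCore c.toCore
  let b := (stdOrthonormalBasis ℂ V).reindex (finCongr hr)
  refine ⟨b.toBasis, fun i j => ?_⟩
  have := orthonormal_iff_ite.mp b.orthonormal j i
  simp only [OrthonormalBasis.coe_toBasis, eq_comm (a := i)]
  exact this

end PosDef

end

noncomputable section

/-! ### Forms of type `(1,1)` -/

section FormCoefficients

variable {n : ℕ} {X : Type*} [TopologicalSpace X] [ChartedSpace (Cn n) X] {x : X}

lemma dz_coordVec (γ α : Fin n) : dz n x γ (coordVec n x α) = if γ = α then 1 else 0 := by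
  change (EuclideanSpace.single α (1 : ℂ) : Cn n) γ = _
  simp

lemma dz_I_smul (γ : Fin n) (v : TanSp n x) :
    dz n x γ (Complex.I • v) = Complex.I * dz n x γ v := rfl

lemma OneForm.bar_apply (a : OneForm n x) (v : TanSp n x) : a.bar v = conj (a v) := rfl

lemma OneForm.wedge_apply (a b : OneForm n x) (v : Fin 2 → TanSp n x) :
    a.wedge b v = a (v 0) * b (v 1) - a (v 1) * b (v 0) := rfl

lemma TwoForm.sum_apply {ι : Type*} (s : Finset ι) (η : ι → TwoForm n x) (v : Fin 2 → TanSp n x) :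
    (∑ p ∈ s, η p) v = ∑ p ∈ s, η p v :=
  map_sum ({ toFun := fun η => η v, map_zero' := rfl, map_add' := fun _ _ => rfl } :
    TwoForm n x →+ ℂ) η s

/-- The `2`-form `∑ c_{αβ} dz^α ∧ dz̄^β`. -/
def form11 (x : X) (c : Fin n → Fin n → ℂ) : TwoForm n x :=
  ∑ α, ∑ β, c α β • (dz n x α).wedge (dz n x β).bar

lemma form11_apply (c : Fin n → Fin n → ℂ) (v : Fin 2 → TanSp n x) :
    form11 x c v = ∑ α, ∑ β, c α β *
      (dz n x α (v 0) * conj (dz n x β (v 1)) - dz n x α (v 1) * conj (dz n x β (v 0))) := by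
  simp only [form11, TwoForm.sum_apply, AlternatingMap.smul_apply, smul_eq_mul,
    OneForm.wedge_apply, OneForm.bar_apply]

/-- The value at `(∂_α, ∂_β)` is `c α β - c β α`; with the second vector multiplied by `I` it is `-I
* (c α β + c β α)`. Together they isolate `c α β`. -/
lemma form11_coeff (c : Fin n → Fin n → ℂ) (α β : Fin n) :
    (form11 x c ![coordVec n x α, coordVec n x β]
      + Complex.I * form11 x c ![coordVec n x α, Complex.I • coordVec n x β]) / 2 = c α β := by
  simp only [form11_apply, Matrix.cons_val_zero, Matrix.cons_val_one, dz_I_smul, dz_coordVec,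
    map_mul, Complex.conj_I, apply_ite conj, map_one, map_zero, mul_sub, Finset.sum_sub_distrib]
  simp only [mul_ite, mul_one, mul_zero, ite_mul, zero_mul, one_mul, mul_neg,
    Finset.sum_ite_eq', Finset.mem_univ, if_true, Finset.sum_neg_distrib]
  linear_combination (-(c α β) / 2 - c β α / 2) * Complex.I_mul_I

lemma form11_injective : Function.Injective (form11 (n := n) x) := by
  intro c d hcd
  ext α β
  rw [← form11_coeff (x := x) c, hcd, form11_coeff]

lemma sum_coordVec (v : TanSp n x) :
    v = ∑ α, (dz n x α v) • coordVec n x α := by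
  have h := (EuclideanSpace.basisFun (Fin n) ℂ).sum_repr (show Cn n from v)
  simp only [EuclideanSpace.basisFun_apply] at h
  exact h.symm

lemma complex_smul_eq (c : ℂ) (v : TanSp n x) :
    c • v = c.re • v + c.im • (Complex.I • v) := by
  have h : ∀ w : Cn n, c • w = c.re • w + c.im • (Complex.I • w) := by
    intro w
    conv_lhs => rw [← Complex.re_add_im c, add_smul, mul_smul]
    rfl
  exact h v

/-- The form is only real-linear, so each complex coordinate is split into real and imaginary parts
and the type condition handles the factor `I`. -/
lemma OneForm.IsType10.eq_sum {a : OneForm n x} (ha : a.IsType10) (v : TanSp n x) :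
    a v = ∑ α, a.coeff α * dz n x α v := by
  conv_lhs => rw [sum_coordVec v, map_sum]
  refine Finset.sum_congr rfl fun α _ => ?_
  rw [complex_smul_eq, map_add, map_smul, map_smul, ha, Complex.real_smul, Complex.real_smul,
    OneForm.coeff]
  conv_rhs => rw [← Complex.re_add_im (dz n x α v)]
  ring

lemma OneForm.IsType01.eq_sum {a : OneForm n x} (ha : a.IsType01) (v : TanSp n x) :
    a v = ∑ α, a.coeff α * conj (dz n x α v) := by
  conv_lhs => rw [sum_coordVec v, map_sum]
  refine Finset.sum_congr rfl fun α _ => ?_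
  rw [complex_smul_eq, map_add, map_smul, map_smul, ha, Complex.real_smul, Complex.real_smul,
    OneForm.coeff]
  conv_rhs => rw [← Complex.re_add_im (dz n x α v)]
  simp only [map_add, map_mul, Complex.conj_ofReal, Complex.conj_I]
  ring

lemma OneForm.IsType10.wedge_bar {a b : OneForm n x} (ha : a.IsType10) (hb : b.IsType10) :
    a.wedge b.bar = form11 x fun α β => a.coeff α * conj (b.coeff β) := by
  ext v
  simp only [OneForm.wedge_apply, OneForm.bar_apply, form11_apply]
  rw [ha.eq_sum (v 0), ha.eq_sum (v 1), hb.eq_sum (v 0), hb.eq_sum (v 1)]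
  simp only [map_sum, map_mul, Finset.sum_mul_sum, ← Finset.sum_sub_distrib]
  refine Finset.sum_congr rfl fun α _ => Finset.sum_congr rfl fun β _ => ?_
  ring

/-- Reordering `dz̄^β ∧ dz^α = -dz^α ∧ dz̄^β` produces the sign and attaches the index `α` to `b`.
-/
lemma OneForm.IsType01.wedge_bar {a b : OneForm n x} (ha : a.IsType01) (hb : b.IsType01) :
    a.wedge b.bar = -form11 x fun α β => conj (b.coeff α) * a.coeff β := by
  ext v
  simp only [OneForm.wedge_apply, OneForm.bar_apply, AlternatingMap.neg_apply, form11_apply]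
  rw [ha.eq_sum (v 0), ha.eq_sum (v 1), hb.eq_sum (v 0), hb.eq_sum (v 1)]
  simp only [map_sum, map_mul, Complex.conj_conj, Finset.sum_mul_sum, ← Finset.sum_sub_distrib,
    ← Finset.sum_neg_distrib]
  rw [Finset.sum_comm]
  refine Finset.sum_congr rfl fun α _ => Finset.sum_congr rfl fun β _ => ?_
  ring

lemma form11_sum {ι : Type*} (s : Finset ι) (c : ι → Fin n → Fin n → ℂ) :
    ∑ p ∈ s, form11 x (c p) = form11 x fun α β => ∑ p ∈ s, c p α β := by
  ext v
  simp only [TwoForm.sum_apply, form11_apply, Finset.sum_mul]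
  exact Finset.sum_comm.trans (Finset.sum_congr rfl fun α _ => Finset.sum_comm)

/-- The `(1,0)`-form with given coefficients. -/
def OneForm.of10 (x : X) (c : Fin n → ℂ) : OneForm n x := ∑ α, c α • dz n x α

/-- The `(0,1)`-form with given coefficients. -/
def OneForm.of01 (x : X) (c : Fin n → ℂ) : OneForm n x := ∑ α, c α • (dz n x α).bar

lemma OneForm.of10_apply (c : Fin n → ℂ) (v : TanSp n x) :
    OneForm.of10 x c v = ∑ α, c α * dz n x α v := by
  simp [OneForm.of10, LinearMap.sum_apply]

lemma OneForm.of01_apply (c : Fin n → ℂ) (v : TanSp n x) :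
    OneForm.of01 x c v = ∑ α, c α * conj (dz n x α v) := by
  simp [OneForm.of01, LinearMap.sum_apply, OneForm.bar_apply]

lemma OneForm.isType10_of10 (c : Fin n → ℂ) : (OneForm.of10 x c).IsType10 := by
  intro v
  simp only [OneForm.of10_apply, dz_I_smul, Finset.mul_sum]
  exact Finset.sum_congr rfl fun α _ => by ring

lemma OneForm.isType01_of01 (c : Fin n → ℂ) : (OneForm.of01 x c).IsType01 := by
  intro v
  simp only [OneForm.of01_apply, dz_I_smul, Finset.mul_sum, ← Finset.sum_neg_distrib, map_mul,
    Complex.conj_I]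
  exact Finset.sum_congr rfl fun α _ => by ring

lemma OneForm.coeff_of10 (c : Fin n → ℂ) (α : Fin n) : (OneForm.of10 x c).coeff α = c α := by
  simp [OneForm.coeff, OneForm.of10_apply, dz_coordVec]

lemma OneForm.coeff_of01 (c : Fin n → ℂ) (α : Fin n) : (OneForm.of01 x c).coeff α = c α := by
  simp [OneForm.coeff, OneForm.of01_apply, dz_coordVec, apply_ite conj]

end FormCoefficients

end

noncomputable section

/-! ### Holomorphic frames -/

section Frames

variable {n r : ℕ} {X : Type*} [TopologicalSpace X] [ChartedSpace (Cn n) X]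
  {E : X → Type*} [TopologicalSpace (Bundle.TotalSpace (Cn r) E)]
  [∀ x, AddCommGroup (E x)] [∀ x, Module ℂ (E x)] [∀ x, TopologicalSpace (E x)]
  [FiberBundle (Cn r) E]

lemma contDiffAt_comp_chart_symm {𝕜 : Type*} [NontriviallyNormedField 𝕜] [NormedSpace 𝕜 (Cn n)]
    [NormedSpace 𝕜 ℂ] {k : ℕ∞ω} {f : X → ℂ} {x : X}
    (hf : ContMDiffAt 𝓘(𝕜, Cn n) 𝓘(𝕜, ℂ) k f x) :
    ContDiffAt 𝕜 k (fun z => f ((chartAt (Cn n) x).symm z)) (chartAt (Cn n) x x) := by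
  have := (contMDiffAt_iff.mp hf).2
  rw [modelWithCornersSelf_coe, Set.range_id, contDiffWithinAt_univ] at this
  exact this

namespace HermitianMetric

variable (h : HermitianMetric n r E)

lemma gram_chart (e : Fin r → Π y : X, E y) (x : X) (i k : Fin r) :
    h.gram e x (chartAt (Cn n) x x) i k = h.form x (e i x) (e k x) := by
  -- The fibre depends on the base point, so the equality of points is eliminated with a variable
  -- `y` rather than rewritten.
  have key : ∀ y, y = x → h.form y (e i y) (e k y) = h.form x (e i x) (e k x) := by
    rintro y rfl; rfl
  exact key _ ((chartAt (Cn n) x).left_inv (mem_chart_source _ x))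

lemma contDiffAt_gram {e : Fin r → Π y : X, E y} {x : X} (he : IsHolFrameNear n r E x e)
    (i k : Fin r) :
    ContDiffAt ℝ 2 (fun z => h.gram e x z i k) (chartAt (Cn n) x x) := by
  obtain ⟨U, hU, hxU, hframe⟩ := he
  have h1 := (h.smooth U hU (e i) (e k) (hframe.contMDiffOn i) (hframe.contMDiffOn k)).contMDiffAt
    (hU.mem_nhds hxU)
  exact contDiffAt_infty.mp (contDiffAt_comp_chart_symm h1) 2

/-- The matrix `(R_{i j̄ α β̄})_{ij}`. -/
def lowerMat (e : Fin r → Π y : X, E y) (x : X) (α β : Fin n) : Matrix (Fin r) (Fin r) ℂ :=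
  Matrix.of fun i j => h.curvatureLower e x i j α β

/-- `chernMat` has `θ^j_i` in row `i` and column `j`, the transpose of the curvature convention;
this makes lowering the index a right multiplication by the Gram matrix. -/
lemma lowerMat_eq (e : Fin r → Π y : X, E y) (x : X) (α β : Fin n) :
    h.lowerMat e x α β = -(wirtingerBarMat β (chernMat α (h.gram e x)) (chartAt (Cn n) x x)
      * h.gram e x (chartAt (Cn n) x x)) := by
  ext i j
  simp only [lowerMat, Matrix.of_apply, curvatureLower, Matrix.neg_apply, Matrix.mul_apply,
    gram_chart, ← Finset.sum_neg_distrib, curvatureCoeff, neg_mul]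
  rfl

lemma lowerMat_change_frame {e f : Fin r → Π y : X, E y} {x : X}
    (he : IsHolFrameNear n r E x e) (hf : IsHolFrameNear n r E x f) (hfu : h.IsUnitaryAt f x)
    {G : Cn n → Matrix (Fin r) (Fin r) ℂ}
    (hG : ∀ i j, AnalyticAt ℂ (fun z => G z i j) (chartAt (Cn n) x x))
    (hGdet : (G (chartAt (Cn n) x x)).det ≠ 0)
    (hefG : ∀ᶠ z in nhds (chartAt (Cn n) x x), ∀ i, e i ((chartAt (Cn n) x).symm z)
      = ∑ j, G z i j • f j ((chartAt (Cn n) x).symm z)) (α β : Fin n) :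
    h.lowerMat e x α β = G (chartAt (Cn n) x x) * h.lowerMat f x α β
      * (G (chartAt (Cn n) x x)).conjTranspose := by
  have hgram : h.gram e x =ᶠ[nhds (chartAt (Cn n) x x)]
      fun z => G z * h.gram f x z * (G z).conjTranspose := by
    filter_upwards [hefG] with z hz
    ext i k
    simp only [gram, Matrix.of_apply, hz, Matrix.mul_apply, Matrix.conjTranspose_apply, map_sum,
      LinearMap.sum_apply, map_smul, LinearMap.smul_apply, LinearMap.map_smulₛₗ, smul_eq_mul,
      Finset.sum_mul, Finset.mul_sum]
    refine Finset.sum_congr rfl fun a _ => Finset.sum_congr rfl fun b _ => ?_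
    simp only [RCLike.star_def]
    ring
  -- Unitarity of `f` serves only to make its Gram matrix invertible at the point.
  have hdet : (h.gram f x (chartAt (Cn n) x x)).det ≠ 0 := by
    have : h.gram f x (chartAt (Cn n) x x) = 1 := by
      ext i k
      rw [gram_chart, hfu, Matrix.one_apply]
    simp [this]
  have key := wirtingerBarMat_chernMat_change_frame (α := α) (β := β) (h.contDiffAt_gram hf)
    (h.contDiffAt_gram he) hG hdet hGdet hgram
  rw [lowerMat_eq, lowerMat_eq, hgram.self_of_nhds, ← mul_assoc, ← mul_assoc, key]
  simp only [mul_neg, neg_mul, mul_assoc]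

end HermitianMetric

lemma IsHolFrameNear.linearIndependent {e : Fin r → Π y : X, E y} {x : X}
    (he : IsHolFrameNear n r E x e) : LinearIndependent ℂ (fun i => e i x) := by
  obtain ⟨U, -, hxU, hframe⟩ := he
  exact hframe.linearIndependent hxU

variable [VectorBundle ℂ (Cn r) E] [ContMDiffVectorBundle ω (Cn r) E 𝓘(ℂ, Cn n)]

/-- Near every point there is a unitary holomorphic frame through which every holomorphic frame is
expressed by a holomorphic matrix function. -/
lemma HermitianMetric.exists_unitary_frame [IsManifold 𝓘(ℂ, Cn n) ω X]
    (h : HermitianMetric n r E) (x : X) :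
    ∃ f : Fin r → Π y : X, E y, IsHolFrameNear n r E x f ∧ h.IsUnitaryAt f x ∧
      ∀ e : Fin r → Π y : X, E y, IsHolFrameNear n r E x e →
        ∃ G : Cn n → Matrix (Fin r) (Fin r) ℂ,
          (∀ i j, AnalyticAt ℂ (fun z => G z i j) (chartAt (Cn n) x x)) ∧
          ∀ᶠ z in nhds (chartAt (Cn n) x x), ∀ i, e i ((chartAt (Cn n) x).symm z)
            = ∑ j, G z i j • f j ((chartAt (Cn n) x).symm z) := by
  have : ContMDiffVectorBundle 1 (Cn r) E 𝓘(ℂ, Cn n) :=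
    ContMDiffVectorBundle.of_le (n := ω) le_top
  let t := trivializationAt (Cn r) E x
  have hx : x ∈ t.baseSet := FiberBundle.mem_baseSet_trivializationAt' x
  let L := t.linearEquivAt ℂ x hx
  have : FiniteDimensional ℂ (E x) := Module.Finite.equiv L.symm
  obtain ⟨bE, hbE⟩ := exists_orthonormal_basis_of_form (r := r) (by rw [L.finrank_eq]; simp)
    (h.form x) (h.conj_symm x) (h.pos x)
  -- The frame is constant in the trivialization, hence holomorphic; the constant basis is the image
  -- of an orthonormal basis of the fibre `E x`, which makes the frame unitary at `x`.
  let b := bE.map L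
  have hfx : ∀ i, t.localFrame b i x = bE i := fun i => by
    rw [t.localFrame_apply_of_mem_baseSet b hx]
    exact L.symm_apply_apply (bE i)
  refine ⟨t.localFrame b, ⟨t.baseSet, t.open_baseSet, hx,
    t.isLocalFrameOn_localFrame_baseSet 𝓘(ℂ, Cn n) ω b⟩, fun i j => by rw [hfx, hfx, hbE], ?_⟩
  rintro e ⟨U, hU, hxU, hframe⟩
  refine ⟨fun z => Matrix.of fun i j => t.localFrameCoeff 𝓘(ℂ, Cn n) b j
    ((chartAt (Cn n) x).symm z) (e i ((chartAt (Cn n) x).symm z)), fun i j => ?_, ?_⟩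
  · have h1 := contMDiffAt_localFrameCoeff (I := 𝓘(ℂ, Cn n)) b hx (hframe.contMDiffAt hU hxU i) j
    exact (contDiffAt_comp_chart_symm h1).analyticAt
  · have h1 : Filter.Tendsto (chartAt (Cn n) x).symm (nhds (chartAt (Cn n) x x)) (nhds x) := by
      have := (chartAt (Cn n) x).continuousAt_symm (mem_chart_target (Cn n) x)
      rwa [ContinuousAt, (chartAt (Cn n) x).left_inv (mem_chart_source _ x)] at this
    filter_upwards [h1 (t.open_baseSet.mem_nhds hx)] with z hz i
    exact t.eq_sum_localFrameCoeff_smul (I := 𝓘(ℂ, Cn n)) (s := e i) hz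

/-- The curvature tensors in two holomorphic frames are congruent by an invertible matrix. -/
lemma HermitianMetric.exists_lowerMat_eq [IsManifold 𝓘(ℂ, Cn n) ω X]
    (h : HermitianMetric n r E) (x : X) :
    ∃ f : Fin r → Π y : X, E y, IsHolFrameNear n r E x f ∧ h.IsUnitaryAt f x ∧
      ∀ e : Fin r → Π y : X, E y, IsHolFrameNear n r E x e →
        ∃ G : Matrix (Fin r) (Fin r) ℂ, IsUnit G ∧
          ∀ α β, h.lowerMat e x α β = G * h.lowerMat f x α β * G.conjTranspose := by
  obtain ⟨f, hf, hfu, hfe⟩ := h.exists_unitary_frame x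
  refine ⟨f, hf, hfu, fun e he => ?_⟩
  obtain ⟨G, hG, hefG⟩ := hfe e he
  -- A linear relation between the rows of `G` at the point would be one between the vectors `e i
  -- x`.
  have hu : IsUnit (G (chartAt (Cn n) x x)) := by
    rw [← Matrix.linearIndependent_rows_iff_isUnit, Fintype.linearIndependent_iff]
    intro c hc
    have key : ∀ y, y = x → (∀ i, e i y = ∑ j, G (chartAt (Cn n) x x) i j • f j y) →
        ∀ i, e i x = ∑ j, G (chartAt (Cn n) x x) i j • f j x := by
      rintro y rfl hy; exact hy
    have hex := key _ ((chartAt (Cn n) x).left_inv (mem_chart_source _ x)) hefG.self_of_nhds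
    refine Fintype.linearIndependent_iff.mp he.linearIndependent c ?_
    simp only [hex, Finset.smul_sum, smul_smul]
    rw [Finset.sum_comm]
    refine Finset.sum_eq_zero fun j _ => ?_
    have hcj := congrFun hc j
    simp only [Finset.sum_apply, Pi.smul_apply, smul_eq_mul, Matrix.row, Pi.zero_apply] at hcj
    rw [← Finset.sum_smul, hcj, zero_smul]
  exact ⟨_, hu, fun α β => h.lowerMat_change_frame he hf hfu hG
    ((Matrix.isUnit_iff_isUnit_det _).mp hu).ne_zero hefG α β⟩

end Frames

end

noncomputable section

/-! ### Positivity as positive definiteness of block matrices -/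

section BlockMatrices

open Matrix
open scoped Kronecker

variable {n r : ℕ}

/-- The matrix with entry `L_{i j̄ α β̄}` in row `(j, β)` and column `(i, α)`. -/
def nakanoMat (L : Fin n → Fin n → Matrix (Fin r) (Fin r) ℂ) :
    Matrix (Fin r × Fin n) (Fin r × Fin n) ℂ :=
  Matrix.of fun p q => L q.2 p.2 q.1 p.1

/-- The matrix with entry `L_{i j̄ α β̄}` in row `(i, β)` and column `(j, α)`. -/
def dualNakanoMat (L : Fin n → Fin n → Matrix (Fin r) (Fin r) ℂ) :
    Matrix (Fin r × Fin n) (Fin r × Fin n) ℂ :=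
  Matrix.of fun p q => L q.2 p.2 p.1 q.1

lemma star_dotProduct_nakanoMat_mulVec (L : Fin n → Fin n → Matrix (Fin r) (Fin r) ℂ)
    (x : Fin r × Fin n → ℂ) :
    star x ⬝ᵥ (nakanoMat L *ᵥ x)
      = ∑ i, ∑ j, ∑ α, ∑ β, L α β i j * x (i, α) * conj (x (j, β)) := by
  simp only [dotProduct, mulVec, Fintype.sum_prod_type, nakanoMat, of_apply, Pi.star_apply,
    Finset.mul_sum]
  refine Eq.trans ?_ Finset.sum_comm
  refine Finset.sum_congr rfl fun j _ => Finset.sum_comm.trans ?_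
  refine Finset.sum_congr rfl fun i _ => Finset.sum_comm.trans ?_
  refine Finset.sum_congr rfl fun α _ => Finset.sum_congr rfl fun β _ => ?_
  rw [RCLike.star_def]
  ring

lemma star_dotProduct_dualNakanoMat_mulVec (L : Fin n → Fin n → Matrix (Fin r) (Fin r) ℂ)
    (x : Fin r × Fin n → ℂ) :
    star x ⬝ᵥ (dualNakanoMat L *ᵥ x)
      = ∑ i, ∑ j, ∑ α, ∑ β, L α β i j * x (j, α) * conj (x (i, β)) := by
  simp only [dotProduct, mulVec, Fintype.sum_prod_type, dualNakanoMat, of_apply, Pi.star_apply,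
    Finset.mul_sum]
  refine Finset.sum_congr rfl fun j _ => Finset.sum_comm.trans ?_
  refine Finset.sum_congr rfl fun i _ => Finset.sum_comm.trans ?_
  refine Finset.sum_congr rfl fun α _ => Finset.sum_congr rfl fun β _ => ?_
  rw [RCLike.star_def]
  ring

lemma posDef_iff_forall_uncurry {M : Matrix (Fin r × Fin n) (Fin r × Fin n) ℂ} :
    M.PosDef ↔ ∀ u : Fin r → Fin n → ℂ, u ≠ 0 →
      0 < star (Function.uncurry u) ⬝ᵥ (M *ᵥ Function.uncurry u) := by
  refine ⟨fun hM u hu => hM.dotProduct_mulVec_pos fun h0 => hu ?_,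
    fun hM => posDef_of_forall_pos fun x hx => ?_⟩
  · ext i α
    exact congrFun h0 (i, α)
  · rw [← Function.uncurry_curry x]
    refine hM _ fun h0 => hx ?_
    rw [← Function.uncurry_curry x, h0]
    rfl

lemma isUnit_kronecker_one {K : Matrix (Fin r) (Fin r) ℂ} (hK : IsUnit K) :
    IsUnit (K ⊗ₖ (1 : Matrix (Fin n) (Fin n) ℂ)) := by
  rw [isUnit_iff_isUnit_det] at hK ⊢
  rw [det_kronecker, det_one, one_pow, mul_one]
  exact hK.pow _

/-- The columns of `nakanoMat` carry the linear index `i`, so `G` enters transposed; in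
`dualNakanoMat` they carry the conjugate index `j`, so there it enters as `Gᴴ`. The form indices are
untouched, whence the Kronecker factor `1`. -/
lemma nakanoMat_congruence {L L' : Fin n → Fin n → Matrix (Fin r) (Fin r) ℂ}
    {G : Matrix (Fin r) (Fin r) ℂ} (h : ∀ α β, L' α β = G * L α β * Gᴴ) :
    nakanoMat L' = star (Gᵀ ⊗ₖ (1 : Matrix (Fin n) (Fin n) ℂ)) * nakanoMat L
      * (Gᵀ ⊗ₖ (1 : Matrix (Fin n) (Fin n) ℂ)) := by
  ext ⟨j, β⟩ ⟨i, α⟩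
  simp only [nakanoMat, of_apply, h, star_eq_conjTranspose, conjTranspose_kronecker, mul_apply,
    Fintype.sum_prod_type, kroneckerMap_apply, conjTranspose_one, one_apply, mul_ite, mul_one,
    mul_zero, ite_mul, zero_mul, Finset.sum_ite_eq, Finset.sum_ite_eq', Finset.mem_univ, if_true,
    conjTranspose_apply, transpose_apply, Finset.sum_mul]
  refine Finset.sum_comm.trans ?_
  refine Finset.sum_congr rfl fun k _ => Finset.sum_congr rfl fun l _ => ?_
  ring

lemma dualNakanoMat_congruence {L L' : Fin n → Fin n → Matrix (Fin r) (Fin r) ℂ}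
    {G : Matrix (Fin r) (Fin r) ℂ} (h : ∀ α β, L' α β = G * L α β * Gᴴ) :
    dualNakanoMat L' = star (Gᴴ ⊗ₖ (1 : Matrix (Fin n) (Fin n) ℂ)) * dualNakanoMat L
      * (Gᴴ ⊗ₖ (1 : Matrix (Fin n) (Fin n) ℂ)) := by
  ext ⟨j, β⟩ ⟨i, α⟩
  simp only [dualNakanoMat, of_apply, h, star_eq_conjTranspose, conjTranspose_kronecker, mul_apply,
    Fintype.sum_prod_type, kroneckerMap_apply, conjTranspose_one, one_apply, mul_ite, mul_one,
    mul_zero, ite_mul, zero_mul, Finset.sum_ite_eq, Finset.sum_ite_eq', Finset.mem_univ, if_true,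
    conjTranspose_apply, Finset.sum_mul, star_star]

lemma posDef_nakanoMat_congruence {L L' : Fin n → Fin n → Matrix (Fin r) (Fin r) ℂ}
    {G : Matrix (Fin r) (Fin r) ℂ} (hG : IsUnit G) (h : ∀ α β, L' α β = G * L α β * Gᴴ) :
    (nakanoMat L').PosDef ↔ (nakanoMat L).PosDef := by
  rw [nakanoMat_congruence h]
  have hGt : IsUnit Gᵀ := by
    rwa [isUnit_iff_isUnit_det, det_transpose, ← isUnit_iff_isUnit_det]
  exact (isUnit_kronecker_one hGt).posDef_star_left_conjugate_iff

lemma posDef_dualNakanoMat_congruence {L L' : Fin n → Fin n → Matrix (Fin r) (Fin r) ℂ}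
    {G : Matrix (Fin r) (Fin r) ℂ} (hG : IsUnit G) (h : ∀ α β, L' α β = G * L α β * Gᴴ) :
    (dualNakanoMat L').PosDef ↔ (dualNakanoMat L).PosDef := by
  rw [dualNakanoMat_congruence h]
  exact (isUnit_kronecker_one (star_eq_conjTranspose G ▸ hG.star)).posDef_star_left_conjugate_iff

end BlockMatrices

/-! ### Factorization of the curvature -/

section Factorization

open Matrix

variable {n r : ℕ} {X : Type*} [TopologicalSpace X] [ChartedSpace (Cn n) X]
  {E : X → Type*} [TopologicalSpace (Bundle.TotalSpace (Cn r) E)]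
  [∀ x, AddCommGroup (E x)] [∀ x, Module ℂ (E x)] [∀ x, TopologicalSpace (E x)]
  [FiberBundle (Cn r) E]

namespace HermitianMetric

variable (h : HermitianMetric n r E)

lemma nakanoPositive_iff : h.NakanoPositive ↔
    ∀ (x : X) (e : Fin r → Π y : X, E y), IsHolFrameNear n r E x e →
      (nakanoMat (h.lowerMat e x)).PosDef := by
  simp only [NakanoPositive, posDef_iff_forall_uncurry, star_dotProduct_nakanoMat_mulVec]
  rfl

lemma dualNakanoPositive_iff : h.DualNakanoPositive ↔
    ∀ (x : X) (e : Fin r → Π y : X, E y), IsHolFrameNear n r E x e →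
      (dualNakanoMat (h.lowerMat e x)).PosDef := by
  simp only [DualNakanoPositive, posDef_iff_forall_uncurry, star_dotProduct_dualNakanoMat_mulVec]
  rfl

variable {h} {e : Fin r → Π y : X, E y} {x : X}

lemma IsUnitaryAt.lowerMat_apply (hu : h.IsUnitaryAt e x) (α β : Fin n) (i j : Fin r) :
    h.lowerMat e x α β i j = h.curvatureCoeff e x j i α β := by
  have hu' : ∀ i j, h.form x (e i x) (e j x) = if i = j then 1 else 0 := hu
  simp [lowerMat, curvatureLower, hu']

lemma curvatureMatrix_apply (j i : Fin r) :
    h.curvatureMatrix e x j i = form11 x (h.curvatureCoeff e x j i) := rfl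

/-- The conjugated factor of `conj(B_{ipᾱ}) B_{jpβ̄}` carries the column index `(i, α)`, so the Gram
factor is the conjugate of `coeffMatrix B`. Passing from forms to coefficients loses nothing by
`form11_injective`. -/
lemma IsUnitaryAt.curvatureMatrix_eq_neg_wedge_iff (hu : h.IsUnitaryAt e x) {N : ℕ}
    {B : Matrix (Fin r) (Fin N) (OneForm n x)} (hB : ∀ j p, (B j p).IsType01) :
    h.curvatureMatrix e x = -wedgeTranspose B (B.map OneForm.bar) ↔
      nakanoMat (h.lowerMat e x) = ((coeffMatrix B).map star)ᴴ * (coeffMatrix B).map star := by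
  have h1 : ∀ j i, (-wedgeTranspose B (B.map OneForm.bar)) j i
      = form11 x fun α β => ∑ p, conj ((B i p).coeff α) * (B j p).coeff β := fun j i => by
    simp only [Matrix.neg_apply, wedgeTranspose, of_apply, map_apply, (hB _ _).wedge_bar (hB _ _),
      Finset.sum_neg_distrib, neg_neg, form11_sum]
  constructor
  · intro hR
    ext ⟨j, β⟩ ⟨i, α⟩
    have h2 := congrFun (congrFun hR j) i
    rw [h1, curvatureMatrix_apply] at h2
    have h3 := congrFun (congrFun (form11_injective h2) α) β
    simp only [nakanoMat, of_apply, hu.lowerMat_apply, h3, mul_apply, conjTranspose_apply,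
      map_apply, star_star, coeffMatrix]
    exact Finset.sum_congr rfl fun p _ => mul_comm _ _
  · intro hM
    ext1 j i
    rw [h1, curvatureMatrix_apply]
    congr 1
    ext α β
    have h2 := congrFun (congrFun hM (j, β)) (i, α)
    simp only [nakanoMat, of_apply, hu.lowerMat_apply, mul_apply, conjTranspose_apply,
      map_apply, star_star, coeffMatrix] at h2
    rw [h2]
    exact Finset.sum_congr rfl fun p _ => mul_comm _ _

lemma IsUnitaryAt.curvatureMatrix_eq_wedge_iff (hu : h.IsUnitaryAt e x) {N : ℕ}
    {A : Matrix (Fin r) (Fin N) (OneForm n x)} (hA : ∀ j p, (A j p).IsType10) :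
    h.curvatureMatrix e x = wedgeTranspose A (A.map OneForm.bar) ↔
      dualNakanoMat (h.lowerMat e x) = (coeffMatrix A)ᴴ * coeffMatrix A := by
  have h1 : ∀ j i, (wedgeTranspose A (A.map OneForm.bar)) j i
      = form11 x fun α β => ∑ p, (A j p).coeff α * conj ((A i p).coeff β) := fun j i => by
    simp only [wedgeTranspose, of_apply, map_apply, (hA _ _).wedge_bar (hA _ _), form11_sum]
  constructor
  · intro hR
    ext ⟨i, β⟩ ⟨j, α⟩
    have h2 := congrFun (congrFun hR j) i
    rw [h1, curvatureMatrix_apply] at h2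
    have h3 := congrFun (congrFun (form11_injective h2) α) β
    simp only [dualNakanoMat, of_apply, hu.lowerMat_apply, h3, mul_apply, conjTranspose_apply,
      coeffMatrix]
    exact Finset.sum_congr rfl fun p _ => mul_comm _ _
  · intro hM
    ext1 j i
    rw [h1, curvatureMatrix_apply]
    congr 1
    ext α β
    have h2 := congrFun (congrFun hM (i, β)) (j, α)
    simp only [dualNakanoMat, of_apply, hu.lowerMat_apply, mul_apply, conjTranspose_apply,
      coeffMatrix] at h2
    rw [h2]
    exact Finset.sum_congr rfl fun p _ => mul_comm _ _

lemma IsUnitaryAt.posDef_nakanoMat_iff (hu : h.IsUnitaryAt e x) :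
    (nakanoMat (h.lowerMat e x)).PosDef ↔
      ∃ (N : ℕ) (B : Matrix (Fin r) (Fin N) (OneForm n x)),
        (∀ j p, (B j p).IsType01) ∧
        h.curvatureMatrix e x = -wedgeTranspose B (B.map OneForm.bar) ∧
        (coeffMatrix B).rank = r * n := by
  -- Entrywise conjugation preserves rank, being the conjugate transpose followed by the transpose.
  have hrank : ∀ {N : ℕ} (C : Matrix (Fin N) (Fin r × Fin n) ℂ), (C.map star).rank = C.rank :=
    fun C => (rank_transpose (C.map star)).symm.trans (rank_conjTranspose C)
  have hcard : Fintype.card (Fin r × Fin n) = r * n := by simp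
  constructor
  · intro hM
    obtain ⟨C, hC⟩ := hM.exists_conjTranspose_mul_self
    -- The forms are read off from the columns of `C`, with the conjugation undone; here `N = rn`.
    let B : Matrix (Fin r) (Fin (Fintype.card (Fin r × Fin n))) (OneForm n x) :=
      Matrix.of fun j p => OneForm.of01 x fun α => star (C p (j, α))
    have hB : ∀ j p, (B j p).IsType01 := fun j p => OneForm.isType01_of01 _
    have hBC : (coeffMatrix B).map star = C := by
      ext p ⟨j, α⟩
      simp [coeffMatrix, B, OneForm.coeff_of01]
    refine ⟨_, B, hB, (hu.curvatureMatrix_eq_neg_wedge_iff hB).mpr (by rw [hBC, hC]), ?_⟩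
    rw [← hrank, hBC, ← hcard, ← posDef_conjTranspose_mul_self_iff_rank, ← hC]
    exact hM
  · rintro ⟨N, B, hB, hR, hr⟩
    rw [(hu.curvatureMatrix_eq_neg_wedge_iff hB).mp hR, posDef_conjTranspose_mul_self_iff_rank,
      hrank, hr, hcard]

lemma IsUnitaryAt.posDef_dualNakanoMat_iff (hu : h.IsUnitaryAt e x) :
    (dualNakanoMat (h.lowerMat e x)).PosDef ↔
      ∃ (N : ℕ) (A : Matrix (Fin r) (Fin N) (OneForm n x)),
        (∀ j p, (A j p).IsType10) ∧
        h.curvatureMatrix e x = wedgeTranspose A (A.map OneForm.bar) ∧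
        (coeffMatrix A).rank = r * n := by
  have hcard : Fintype.card (Fin r × Fin n) = r * n := by simp
  constructor
  · intro hM
    obtain ⟨C, hC⟩ := hM.exists_conjTranspose_mul_self
    let A : Matrix (Fin r) (Fin (Fintype.card (Fin r × Fin n))) (OneForm n x) :=
      Matrix.of fun j p => OneForm.of10 x fun α => C p (j, α)
    have hA : ∀ j p, (A j p).IsType10 := fun j p => OneForm.isType10_of10 _
    have hAC : coeffMatrix A = C := by
      ext p ⟨j, α⟩
      simp [coeffMatrix, A, OneForm.coeff_of10]
    refine ⟨_, A, hA, (hu.curvatureMatrix_eq_wedge_iff hA).mpr (by rw [hAC, hC]), ?_⟩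
    rw [hAC, ← hcard, ← posDef_conjTranspose_mul_self_iff_rank, ← hC]
    exact hM
  · rintro ⟨N, A, hA, hR, hr⟩
    rw [(hu.curvatureMatrix_eq_wedge_iff hA).mp hR, posDef_conjTranspose_mul_self_iff_rank, hr,
      hcard]

end HermitianMetric

end Factorization

end

theorem corollary4p2 (n r : ℕ) {X : Type*} [TopologicalSpace X] [ChartedSpace (Cn n) X]
    [IsManifold 𝓘(ℂ, Cn n) ω X]
    (E : X → Type*) [TopologicalSpace (Bundle.TotalSpace (Cn r) E)]
    [∀ x, AddCommGroup (E x)] [∀ x, Module ℂ (E x)] [∀ x, TopologicalSpace (E x)]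
    [FiberBundle (Cn r) E] [VectorBundle ℂ (Cn r) E]
    [ContMDiffVectorBundle ω (Cn r) E 𝓘(ℂ, Cn n)]
    (h : HermitianMetric n r E) :
    (h.NakanoPositive ↔
      ∀ x : X, ∃ e : Fin r → Π y : X, E y, IsHolFrameNear n r E x e ∧ h.IsUnitaryAt e x ∧
        ∃ (N : ℕ) (B : Matrix (Fin r) (Fin N) (OneForm n x)),
          (∀ j p, (B j p).IsType01) ∧
          h.curvatureMatrix e x = -wedgeTranspose B (B.map OneForm.bar) ∧
          (coeffMatrix B).rank = r * n) ∧
    (h.DualNakanoPositive ↔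
      ∀ x : X, ∃ e : Fin r → Π y : X, E y, IsHolFrameNear n r E x e ∧ h.IsUnitaryAt e x ∧
        ∃ (N : ℕ) (A : Matrix (Fin r) (Fin N) (OneForm n x)),
          (∀ j p, (A j p).IsType10) ∧
          h.curvatureMatrix e x = wedgeTranspose A (A.map OneForm.bar) ∧
          (coeffMatrix A).rank = r * n) := by
  refine ⟨h.nakanoPositive_iff.trans ⟨fun hpos x => ?_, fun hfac x e he => ?_⟩,
    h.dualNakanoPositive_iff.trans ⟨fun hpos x => ?_, fun hfac x e he => ?_⟩⟩
  · obtain ⟨f, hf, hfu, -⟩ := h.exists_lowerMat_eq x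
    exact ⟨f, hf, hfu, hfu.posDef_nakanoMat_iff.mp (hpos x f hf)⟩
  · obtain ⟨f, -, -, hchange⟩ := h.exists_lowerMat_eq x
    obtain ⟨e₀, he₀, hu, hB⟩ := hfac x
    obtain ⟨G, hG, hGe⟩ := hchange e he
    obtain ⟨G₀, hG₀, hGe₀⟩ := hchange e₀ he₀
    -- The arbitrary frame `e` and the factorizing frame `e₀` are compared through the reference
    -- frame `f`.
    rw [posDef_nakanoMat_congruence hG hGe, ← posDef_nakanoMat_congruence hG₀ hGe₀]
    exact hu.posDef_nakanoMat_iff.mpr hB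
  · obtain ⟨f, hf, hfu, -⟩ := h.exists_lowerMat_eq x
    exact ⟨f, hf, hfu, hfu.posDef_dualNakanoMat_iff.mp (hpos x f hf)⟩
  · obtain ⟨f, -, -, hchange⟩ := h.exists_lowerMat_eq x
    obtain ⟨e₀, he₀, hu, hA⟩ := hfac x
    obtain ⟨G, hG, hGe⟩ := hchange e he
    obtain ⟨G₀, hG₀, hGe₀⟩ := hchange e₀ he₀
    rw [posDef_dualNakanoMat_congruence hG hGe, ← posDef_dualNakanoMat_congruence hG₀ hGe₀]
    exact hu.posDef_dualNakanoMat_iff.mpr hA
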